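/- Game. Let $G$ be a finite connected graph and let $\rho\ge 0$ be an integer. The cop fixes in advance a walk (his patrol) $c_0,c_1,c_2,\dots$ in $G$, and the robber, who knows the whole patrol, chooses a walk $r_0,r_1,r_2,\dots$ in $G$; in each step of its walk a player either moves to an adjacent vertex or stays where he is. The play runs alternately: the cop is placed on $c_0$, the robber on $r_0$, and then, for $t=0,1,2,\dots$, the cop moves from $c_t$ to $c_{t+1}$ and after that the robber moves from $r_t$ to $r_{t+1}$. The robber is captured if at some moment his distance to the cop is at most $\rho$, that is, if $d_G(c_t,r_t)\le\rho$ or $d_G(c_{t+1},r_t)\le\rho$ for some $t\ge 0$. The cop wins with radius of capture $\rho$ if some patrol captures every robber, and $\rho(G)$ denotes the least $\rho$ with which the cop wins on $G$. Theorem. Let $P_k$ denote the path on $k$ vertices and $\Box$ the Cartesian product of graphs. For all integers $1\le n\le m$, $$\min\left\{\frac{n-3}{2},\ \frac{2m+n-10}{8}\right\}\ \le\ \rho(P_n\,\Box\,P_m)\ \le\ \frac n2 .$$ -/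

import Mathlib

/-- A lazy walk in `G`: at every step the player stays put or moves along an edge. -/
def SimpleGraph.IsLazyWalk {V : Type*} (G : SimpleGraph V) (w : ℕ → V) : Prop :=
  ∀ t : ℕ, w (t + 1) = w t ∨ G.Adj (w t) (w (t + 1))

/-- The play in which the cop follows `c` and the robber follows `r`. The cop takes position `c 0`,
the robber takes position `r 0`, and then they alternate: the cop moves from `c t` to `c (t + 1)`
while the robber is at `r t`, after which the robber moves from `r t` to `r (t + 1)`. The robber is
captured with radius `ρ` if at some moment of the play the players are at distance at most `ρ`,
be it after a move of the robber (positions `c t`, `r t`) or after a move of the cop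
(positions `c (t + 1)`, `r t`). -/
def SimpleGraph.IsCaptured {V : Type*} (G : SimpleGraph V) (ρ : ℕ) (c r : ℕ → V) : Prop :=
  ∃ t : ℕ, G.edist (c t) (r t) ≤ (ρ : ℕ∞) ∨ G.edist (c (t + 1)) (r t) ≤ (ρ : ℕ∞)

/-- The cop wins on `G` with radius of capture `ρ`: there is a patrol, fixed in advance, on which
he captures every robber. The robber, who knows the whole patrol, may use any walk. -/
def SimpleGraph.PatrolWins {V : Type*} (G : SimpleGraph V) (ρ : ℕ) : Prop :=
  ∃ c : ℕ → V, G.IsLazyWalk c ∧ ∀ r : ℕ → V, G.IsLazyWalk r → G.IsCaptured ρ c r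

/-- The minimum radius of capture with which the cop wins on `G`. -/
noncomputable def SimpleGraph.patrolRange {V : Type*} (G : SimpleGraph V) : ℕ :=
  sInf {ρ : ℕ | G.PatrolWins ρ}

/-- On a finite connected graph the minimum in the definition of `patrolRange` is attained. -/
theorem SimpleGraph.Connected.isLeast_patrolRange {V : Type*} [Finite V] {G : SimpleGraph V}
    (hG : G.Connected) : IsLeast {ρ : ℕ | G.PatrolWins ρ} G.patrolRange := by
  have hne : {ρ : ℕ | G.PatrolWins ρ}.Nonempty := by
    obtain ⟨v⟩ := hG.nonempty
    obtain ⟨N, hN⟩ := (Set.finite_range fun u : V => G.dist v u).bddAbove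
    refine ⟨N, fun _ => v, fun _ => Or.inl rfl, fun r _ => ⟨0, Or.inl ?_⟩⟩
    rw [← (hG v (r 0)).coe_dist_eq_edist]
    exact_mod_cast hN ⟨r 0, rfl⟩
  exact ⟨Nat.sInf_mem hne, fun ρ hρ => Nat.sInf_le hρ⟩

/-!
Coordinates: `x ∈ [0, M]`, `M = m - 1`, runs along `P_m`, and `y ∈ [0, N]`, `N = n - 1`, along
`P_n`, so that graph distance on the grid is the `ℓ¹` distance.

*Upper bound.* The cop patrols the middle row from left to right. Whenever the robber is in the
column of the cop he is within `n / 2`, so he is captured; hence he stays strictly to the right of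
the cop, which is impossible once the cop is in the last column (`patrolWins_grid`).

*Lower bound.* Put `D = ρ + 2`. A robber whose distance to the cop is at least `D` after each of
his own moves is at distance at least `ρ + 1` after the next move of the cop, so he is never
captured. Call a point *hot* at time `t` if a robber keeping distance `D` can be there; by
compactness it is enough that there is a hot point at every time (`exists_not_isCaptured`). The
hot points are followed along the sphere of radius `D` around the cop, which has four edges,
NE, NW, SE and SW. The points of the NE edge are the tokens `tok t w`, `0 ≤ w ≤ D`, moving along
with the cop. A hot token stays hot, and every cop step right or down (left or up) lets heat spread
by one token towards the top (the right) end, as long as the NE edge meets the rectangle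
(`tok_move`, `spread_down`, `spread_up`). Ends shared by two edges carry the heat from one edge to
the next (`tok_flipX`, `tok_flipY`).

An edge leaves the rectangle exactly when the cop is within distance `D - 1` of the corresponding
corner, and then the opposite edge is there. So only the corner visits of the cop matter. The
invariant `Inv` says that, when the cop is in the SW corner, the NE edge is hot at its top end and at
a token which will be the right end by the time the cop has climbed to within `D - 1` of the top
side, or the mirror image of that in the diagonal. It is kept from one corner visit to the next:
trivially if the same corner is visited again, by `inv_NW` for an adjacent corner and by
`inv_NE_of_invT` for the opposite corner. The assumption `2m + n ≥ 8ρ + 11`, in the form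
`M + N ≥ 5D - 4`, makes the way of the cop
long enough for the heat to spread around the sphere. All other cases follow by the symmetries
`flipX`, `flipY`, `swap` of the rectangle. The invariant provides a hot token at every time
(`exists_hot`).
-/

/-! ### Pursuit in a rectangle and its symmetries -/

/-- A cop walking in the rectangle `[0, M] × [0, N]`, with position `(x t, y t)` at time `t`, and
for each time a set `hot t` of points at which a robber who keeps `ℓ¹` distance at least `D` from
the cop may be. The conditions on these data are collected in `Chase.Legal`. -/
structure Chase where
  D : ℤ
  M : ℤ
  N : ℤ
  x : ℕ → ℤ
  y : ℕ → ℤ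
  hot : ℕ → ℤ → ℤ → Prop

namespace Chase

/-- A lazy step in the plane grid, from `(u, v)` to `(u', v')`. -/
def Step (u v u' v' : ℤ) : Prop :=
  (u' = u ∧ v' = v) ∨ (u' = u + 1 ∧ v' = v) ∨ (u' = u - 1 ∧ v' = v) ∨
    (u' = u ∧ v' = v + 1) ∨ (u' = u ∧ v' = v - 1)

/-- The cop takes lazy steps in the rectangle, every point at distance at least `D` from the cop is
hot at time `0`, and heat is passed on by lazy steps to points at distance at least `D` from the
cop. Only these closure properties of `hot` are used, not that `hot` is the least such family. The
sides are long enough for the balls of radius `D - 1` around the four corners to be disjoint, and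
`room` is what lets heat spread in time. -/
structure Legal (P : Chase) : Prop where
  two_le : 2 ≤ P.D
  width : 2 * P.D - 1 ≤ P.M
  height : 2 * P.D - 1 ≤ P.N
  room : 5 * P.D - 4 ≤ P.M + P.N
  x_nonneg : ∀ t, 0 ≤ P.x t
  x_le : ∀ t, P.x t ≤ P.M
  y_nonneg : ∀ t, 0 ≤ P.y t
  y_le : ∀ t, P.y t ≤ P.N
  cop : ∀ t, Step (P.x t) (P.y t) (P.x (t + 1)) (P.y (t + 1))
  start : ∀ u v, 0 ≤ u → u ≤ P.M → 0 ≤ v → v ≤ P.N →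
    P.D ≤ |u - P.x 0| + |v - P.y 0| → P.hot 0 u v
  next : ∀ t u v u' v', P.hot t u v → Step u v u' v' → 0 ≤ u' → u' ≤ P.M → 0 ≤ v' → v' ≤ P.N →
    P.D ≤ |u' - P.x (t + 1)| + |v' - P.y (t + 1)| → P.hot (t + 1) u' v'

/-- Reflection of the rectangle exchanging left and right. -/
def flipX (P : Chase) : Chase :=
  { P with x := fun t => P.M - P.x t, hot := fun t u v => P.hot t (P.M - u) v }

/-- Reflection of the rectangle exchanging bottom and top. -/
def flipY (P : Chase) : Chase :=
  { P with y := fun t => P.N - P.y t, hot := fun t u v => P.hot t u (P.N - v) }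

/-- Reflection in the diagonal, exchanging the two coordinates. -/
def swap (P : Chase) : Chase :=
  { D := P.D, M := P.N, N := P.M, x := P.y, y := P.x, hot := fun t u v => P.hot t v u }

@[simp] theorem flipX_flipX (P : Chase) : P.flipX.flipX = P := by
  simp [flipX]

@[simp] theorem flipY_flipY (P : Chase) : P.flipY.flipY = P := by
  simp [flipY]

@[simp] theorem swap_swap (P : Chase) : P.swap.swap = P := rfl

theorem flipY_flipX (P : Chase) : P.flipY.flipX = P.flipX.flipY := rfl

theorem swap_flipX (P : Chase) : P.swap.flipX = P.flipY.swap := rfl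

section Projections

variable {P : Chase}

@[simp] theorem flipX_D : P.flipX.D = P.D := rfl
@[simp] theorem flipX_M : P.flipX.M = P.M := rfl
@[simp] theorem flipX_N : P.flipX.N = P.N := rfl
@[simp] theorem flipX_x (t : ℕ) : P.flipX.x t = P.M - P.x t := rfl
@[simp] theorem flipX_y (t : ℕ) : P.flipX.y t = P.y t := rfl
@[simp] theorem flipX_hot (t : ℕ) (u v : ℤ) : P.flipX.hot t u v = P.hot t (P.M - u) v := rfl
@[simp] theorem flipY_D : P.flipY.D = P.D := rfl
@[simp] theorem flipY_M : P.flipY.M = P.M := rfl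
@[simp] theorem flipY_N : P.flipY.N = P.N := rfl
@[simp] theorem flipY_x (t : ℕ) : P.flipY.x t = P.x t := rfl
@[simp] theorem flipY_y (t : ℕ) : P.flipY.y t = P.N - P.y t := rfl
@[simp] theorem flipY_hot (t : ℕ) (u v : ℤ) : P.flipY.hot t u v = P.hot t u (P.N - v) := rfl
@[simp] theorem swap_D : P.swap.D = P.D := rfl
@[simp] theorem swap_M : P.swap.M = P.N := rfl
@[simp] theorem swap_N : P.swap.N = P.M := rfl
@[simp] theorem swap_x (t : ℕ) : P.swap.x t = P.y t := rfl
@[simp] theorem swap_hot (t : ℕ) (u v : ℤ) : P.swap.hot t u v = P.hot t v u := rfl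
@[simp] theorem swap_y (t : ℕ) : P.swap.y t = P.x t := rfl

end Projections

theorem Legal.flipX {P : Chase} (h : P.Legal) : P.flipX.Legal where
  two_le := h.two_le
  width := h.width
  height := h.height
  room := h.room
  x_nonneg t := by have := h.x_le t; simp only [Chase.flipX]; omega
  x_le t := by have := h.x_nonneg t; simp only [Chase.flipX]; omega
  y_nonneg := h.y_nonneg
  y_le := h.y_le
  cop t := by have := h.cop t; simp only [Chase.flipX, Step] at *; omega
  start u v h1 h2 h3 h4 h5 := by
    simp only [Chase.flipX] at *
    refine h.start _ _ (by omega) (by omega) h3 h4 ?_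
    rwa [show P.M - u - P.x 0 = -(u - (P.M - P.x 0)) by ring, abs_neg]
  next t u v u' v' h0 hs h1 h2 h3 h4 h5 := by
    simp only [Chase.flipX] at *
    refine h.next t _ _ _ _ h0 ?_ (by omega) (by omega) h3 h4 ?_
    · simp only [Step] at *; omega
    · rwa [show P.M - u' - P.x (t + 1) = -(u' - (P.M - P.x (t + 1))) by ring, abs_neg]

theorem Legal.swap {P : Chase} (h : P.Legal) : P.swap.Legal where
  two_le := h.two_le
  width := h.height
  height := h.width
  room := by have := h.room; simp only [Chase.swap]; omega
  x_nonneg := h.y_nonneg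
  x_le := h.y_le
  y_nonneg := h.x_nonneg
  y_le := h.x_le
  cop t := by have := h.cop t; simp only [Chase.swap, Step] at *; omega
  start u v h1 h2 h3 h4 h5 := h.start v u h3 h4 h1 h2 (by simp only [Chase.swap] at h5; linarith)
  next t u v u' v' h0 hs h1 h2 h3 h4 h5 :=
    h.next t v u v' u' h0 (by simp only [Step] at *; omega) h3 h4 h1 h2
      (by simp only [Chase.swap] at h5; linarith)

theorem Legal.flipY {P : Chase} (h : P.Legal) : P.flipY.Legal := by
  simpa [swap_flipX] using h.swap.flipX.swap

/-! ### Tokens on the north-east edge of the sphere -/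

/-- The cop is within distance `D - 1` of the corner `(0, 0)`. -/
def AtSW (P : Chase) (t : ℕ) : Prop := P.x t + P.y t < P.D

/-- The cop is at distance at least `D` from the corner `(M, N)`, equivalently the NE edge of the
sphere of radius `D` around the cop meets the rectangle. For the other corners apply this, or
`AtSW`, to the reflected chase: `P.flipX` for NW, `P.flipY` for SE, `P.flipX.flipY` for SW. -/
def FreeNE (P : Chase) (t : ℕ) : Prop := P.x t + P.y t + P.D ≤ P.M + P.N

/-- The value nearest to `w` among the offsets `i` with `(x + i, y + D - i)` on the part of the NE
edge inside the rectangle (when `FreeNE` holds). -/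
def clamp (P : Chase) (t : ℕ) (w : ℤ) : ℤ :=
  max (max 0 (P.y t + P.D - P.N)) (min w (min P.D (P.M - P.x t)))

/-- The token `w` is hot: the point of the NE edge with offset `w` from its top end, or the nearest
one inside the rectangle. Because of the clamping, tokens `w ≤ 0` are at the top end of the edge
and tokens `w ≥ D` at its right end. -/
def tok (P : Chase) (t : ℕ) (w : ℤ) : Prop :=
  P.hot t (P.x t + P.clamp t w) (P.y t + P.D - P.clamp t w)

variable {P : Chase}

theorem Legal.clamp_mem (h : P.Legal) {t : ℕ} (hf : P.FreeNE t) (w : ℤ) :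
    0 ≤ P.clamp t w ∧ P.clamp t w ≤ P.D ∧ P.clamp t w ≤ P.M - P.x t ∧
      P.y t + P.D - P.N ≤ P.clamp t w := by
  have h1 := h.two_le
  have h3 := h.x_le t
  have h5 := h.y_le t
  unfold FreeNE at hf
  unfold clamp
  refine ⟨?_, ?_, ?_, ?_⟩ <;> omega

theorem Legal.tok_zero (h : P.Legal) (hf : P.FreeNE 0) (w : ℤ) : P.tok 0 w := by
  have h2 := h.x_nonneg 0
  have h4 := h.y_nonneg 0
  obtain ⟨c1, c2, c3, c4⟩ := h.clamp_mem hf w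
  refine h.start _ _ (by omega) (by omega) (by omega) (by omega) ?_
  rw [abs_of_nonneg (by omega), abs_of_nonneg (by omega)]
  omega

/-- A hot token stays hot. In addition when the cop steps left, right, up or down, a robber on token
`w` may step down, up, right or left respectively, and so gets to token `w + 1` (cop left or up) or
`w - 1` (cop right or down). -/
theorem Legal.tok_move (h : P.Legal) {t : ℕ} (hf : P.FreeNE t) (hf' : P.FreeNE (t + 1)) {w w' : ℤ}
    (hw : w' = w ∨ (w' = w + 1 ∧ (P.x (t + 1) = P.x t - 1 ∨ P.y (t + 1) = P.y t + 1)) ∨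
      (w' = w - 1 ∧ (P.x (t + 1) = P.x t + 1 ∨ P.y (t + 1) = P.y t - 1)))
    (hk : P.tok t w) : P.tok (t + 1) w' := by
  have hD : 0 ≤ P.D := by have := h.two_le; omega
  obtain ⟨c1, c2, c3, c4⟩ := h.clamp_mem hf' w'
  have h2 := h.x_nonneg (t + 1)
  have h4 := h.y_nonneg (t + 1)
  unfold tok at *
  refine h.next t _ _ _ _ hk ?_ (by omega) (by omega) (by omega) (by omega) ?_
  · have hc := h.cop t
    have h3 := h.x_le t
    have h5 := h.y_le t
    have h3' := h.x_le (t + 1)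
    have h5' := h.y_le (t + 1)
    clear c1 c2 c3 c4 h2 h4 hk h
    unfold FreeNE at hf hf'
    unfold clamp Step at *
    generalize P.x t = a at *
    generalize P.y t = b at *
    generalize P.x (t + 1) = a' at *
    generalize P.y (t + 1) = b' at *
    generalize P.D = D at *
    generalize P.M = M at *
    generalize P.N = N at *
    rcases hc with ⟨rfl, rfl⟩ | ⟨rfl, rfl⟩ | ⟨rfl, rfl⟩ | ⟨rfl, rfl⟩ | ⟨rfl, rfl⟩
    · obtain rfl : w' = w := by omega
      simp
    · have : w' = w ∨ w' = w - 1 := by omega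
      clear hw; rcases this with rfl | rfl <;> omega
    · have : w' = w ∨ w' = w + 1 := by omega
      clear hw; rcases this with rfl | rfl <;> omega
    · have : w' = w ∨ w' = w + 1 := by omega
      clear hw; rcases this with rfl | rfl <;> omega
    · have : w' = w ∨ w' = w - 1 := by omega
      clear hw; rcases this with rfl | rfl <;> omega
  · rw [abs_of_nonneg (by omega), abs_of_nonneg (by omega)]
    omega

/-! ### Persistence and spreading of hot tokens -/

theorem tok_nonpos {t : ℕ} {w w' : ℤ} (hw : w ≤ 0) (hw' : w' ≤ 0)
    (hk : P.tok t w) : P.tok t w' := by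
  have : P.clamp t w' = P.clamp t w := by unfold clamp; omega
  unfold tok at *
  rwa [this]

theorem tok_ge {t : ℕ} {w w' : ℤ} (hw : P.D ≤ w) (hw' : P.D ≤ w')
    (hk : P.tok t w) : P.tok t w' := by
  have : P.clamp t w' = P.clamp t w := by unfold clamp; omega
  unfold tok at *
  rwa [this]

/-- If the sphere stays below the top side, the NE and NW edges share their top end. -/
theorem Legal.tok_flipX (h : P.Legal) {t : ℕ} (hy : P.y t + P.D ≤ P.N) (hk : P.tok t 0) :
    P.flipX.tok t 0 := by
  have h1 := h.two_le
  have h2 := h.x_nonneg t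
  have h3 := h.x_le t
  have e1 : P.clamp t 0 = 0 := by unfold clamp; omega
  have e2 : P.flipX.clamp t 0 = 0 := by
    unfold clamp
    simp only [flipX_D, flipX_M, flipX_N, flipX_x, flipX_y]
    omega
  unfold tok at *
  rw [e1] at hk
  rw [e2]
  simpa using hk

/-- If the sphere stays left of the right side, the NE and SE edges share their right end. -/
theorem Legal.tok_flipY (h : P.Legal) {t : ℕ} (hx : P.x t + P.D ≤ P.M) (hk : P.tok t P.D) :
    P.flipY.tok t P.D := by
  have h1 := h.two_le
  have h2 := h.y_nonneg t
  have h3 := h.y_le t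
  have e1 : P.clamp t P.D = P.D := by unfold clamp; omega
  have e2 : P.flipY.clamp t P.D = P.D := by
    unfold clamp
    simp only [flipY_D, flipY_M, flipY_N, flipY_x, flipY_y]
    omega
  unfold tok at *
  rw [e1] at hk
  rw [e2]
  simpa using hk

theorem Legal.tok_swap (h : P.Legal) {t : ℕ} (hf : P.FreeNE t) {w w' : ℤ} (hw : w + w' = P.D)
    (hk : P.tok t w) : P.swap.tok t w' := by
  have h1 := h.two_le
  have h3 := h.x_le t
  have h5 := h.y_le t
  have : P.clamp t w = P.D - P.swap.clamp t w' := by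
    unfold clamp FreeNE at *
    simp only [swap_D, swap_M, swap_N, swap_x, swap_y]
    omega
  unfold tok at *
  rw [this] at hk
  simp only [swap_x, swap_y, swap_D, swap_hot]
  convert hk using 1 <;> ring

theorem Legal.tok_stay (h : P.Legal) {s t : ℕ} (hst : s ≤ t)
    (hf : ∀ r, s ≤ r → r ≤ t → P.FreeNE r) {w : ℤ} (hk : P.tok s w) : P.tok t w := by
  induction t, hst using Nat.le_induction with
  | base => exact hk
  | succ t hst ih =>
    exact h.tok_move (hf t hst (by omega)) (hf _ (by omega) le_rfl) (Or.inl rfl)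
      (ih fun r h1 h2 => hf r h1 (by omega))

/-- Each step of the cop to the right or down spreads heat by one token towards the top end; the
number `k` of such steps is bounded below by the displacement of the cop. -/
theorem Legal.spread_down (h : P.Legal) {s t : ℕ} (hst : s ≤ t)
    (hf : ∀ r, s ≤ r → r ≤ t → P.FreeNE r) {w : ℤ} (hk : P.tok s w) :
    ∃ k : ℤ, 0 ≤ k ∧ P.x t - P.x s ≤ k ∧ P.y s - P.y t ≤ k ∧
      (P.x t - P.x s) + (P.y s - P.y t) ≤ k ∧ ∀ j, 0 ≤ j → j ≤ k → P.tok t (w - j) := by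
  induction t, hst using Nat.le_induction with
  | base =>
    refine ⟨0, le_rfl, by simp, by simp, by simp, fun j h1 h2 => ?_⟩
    rw [show j = 0 by omega]; simpa using hk
  | succ t hst ih =>
    obtain ⟨k, k0, k1, k2, k3, hj⟩ := ih fun r h1 h2 => hf r h1 (by omega)
    have f1 := hf t hst (by omega)
    have f2 := hf (t + 1) (by omega) le_rfl
    have hc := h.cop t
    unfold Step at hc
    by_cases hm : P.x (t + 1) = P.x t + 1 ∨ P.y (t + 1) = P.y t - 1
    · refine ⟨k + 1, by omega, by omega, by omega, by omega, fun j h1 h2 => ?_⟩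
      rcases eq_or_lt_of_le h2 with rfl | h2
      · exact h.tok_move f1 f2 (Or.inr (Or.inr ⟨by ring, hm⟩)) (hj k k0 le_rfl)
      · exact h.tok_move f1 f2 (Or.inl rfl) (hj j h1 (by omega))
    · refine ⟨k, by omega, by omega, by omega, by omega, fun j h1 h2 => ?_⟩
      exact h.tok_move f1 f2 (Or.inl rfl) (hj j h1 (by omega))

/-- Each step of the cop to the left or up spreads heat by one token towards the right end. -/
theorem Legal.spread_up (h : P.Legal) {s t : ℕ} (hst : s ≤ t)
    (hf : ∀ r, s ≤ r → r ≤ t → P.FreeNE r) {w : ℤ} (hk : P.tok s w) :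
    ∃ k : ℤ, 0 ≤ k ∧ P.x s - P.x t ≤ k ∧ P.y t - P.y s ≤ k ∧
      (P.x s - P.x t) + (P.y t - P.y s) ≤ k ∧ ∀ j, 0 ≤ j → j ≤ k → P.tok t (w + j) := by
  have hs := h.tok_swap (hf s le_rfl hst) (w' := P.D - w) (by ring) hk
  have hf' : ∀ r, s ≤ r → r ≤ t → P.swap.FreeNE r := fun r h1 h2 => by
    have := hf r h1 h2
    unfold FreeNE at *; simp only [swap_D, swap_M, swap_N, swap_x, swap_y]; omega
  obtain ⟨k, k0, k1, k2, k3, hj⟩ := h.swap.spread_down hst hf' hs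
  simp only [swap_x, swap_y] at k1 k2 k3
  refine ⟨k, k0, by omega, by omega, by omega, fun j h1 h2 => ?_⟩
  exact h.swap.tok_swap (hf' t hst le_rfl) (by simp only [swap_D]; ring) (hj j h1 h2)

/-! ### The invariant at a corner visit -/

/-- The top end of the NE edge is hot, and so is a token which moves towards the right end as the
cop moves up, and which is at the right end (`w ≥ D`) when `y ≥ N - D + 1`, that is, when the
sphere reaches above the top side. -/
def InvT (P : Chase) (t : ℕ) : Prop := P.tok t 0 ∧ P.tok t (P.y t + 2 * P.D - P.N - 1)

/-- The mirror image of `InvT` under `swap`. -/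
def InvR (P : Chase) (t : ℕ) : Prop := P.tok t P.D ∧ P.tok t (P.M - P.D - P.x t + 1)

/-- The property of the NE edge that is kept at the visits of the cop to the SW corner. -/
def Inv (P : Chase) (t : ℕ) : Prop := P.InvT t ∨ P.InvR t

theorem Legal.invR_swap (h : P.Legal) {t : ℕ} (hf : P.FreeNE t) (hi : P.InvT t) :
    P.swap.InvR t :=
  ⟨h.tok_swap hf (by simp) hi.1, h.tok_swap hf (by simp only [swap_D, swap_M, swap_x]; ring) hi.2⟩

theorem Legal.invT_swap (h : P.Legal) {t : ℕ} (hf : P.FreeNE t) (hi : P.InvR t) :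
    P.swap.InvT t :=
  ⟨h.tok_swap hf (by simp) hi.1, h.tok_swap hf (by simp only [swap_D, swap_N, swap_y]; ring) hi.2⟩

theorem Legal.inv_swap (h : P.Legal) {t : ℕ} (hf : P.FreeNE t) (hi : P.Inv t) :
    P.swap.Inv t :=
  hi.elim (fun hi => .inr (h.invR_swap hf hi)) fun hi => .inl (h.invT_swap hf hi)

theorem FreeNE.swap {t : ℕ} (hf : P.FreeNE t) : P.swap.FreeNE t := by
  unfold FreeNE at *; simp only [swap_D, swap_M, swap_N, swap_x, swap_y]; omega

/-- The second token of `InvT` is one of the tokens to which heat may move in `tok_move`: its index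
changes together with `y`. -/
theorem Legal.invT_stay (h : P.Legal) {s t : ℕ} (hst : s ≤ t)
    (hf : ∀ r, s ≤ r → r ≤ t → P.FreeNE r) (hi : P.InvT s) : P.InvT t := by
  induction t, hst using Nat.le_induction with
  | base => exact hi
  | succ t hst ih =>
    obtain ⟨i1, i2⟩ := ih fun r h1 h2 => hf r h1 (by omega)
    have hc := h.cop t
    unfold Step at hc
    refine ⟨h.tok_move (hf t hst (by omega)) (hf _ (by omega) le_rfl) (Or.inl rfl) i1,
      h.tok_move (hf t hst (by omega)) (hf _ (by omega) le_rfl) ?_ i2⟩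
    omega

theorem Legal.inv_stay (h : P.Legal) {s t : ℕ} (hst : s ≤ t)
    (hf : ∀ r, s ≤ r → r ≤ t → P.FreeNE r) (hi : P.Inv s) : P.Inv t := by
  rcases hi with hi | hi
  · exact .inl (h.invT_stay hst hf hi)
  · exact h.swap.inv_swap (hf t hst le_rfl).swap <| .inl <|
      h.swap.invT_stay hst (fun r h1 h2 => (hf r h1 h2).swap) <|
        h.invT_swap (hf s le_rfl hst) hi

/-- If heat has spread from the right end over `x + 2D - M - 1` tokens, then `InvR` holds. -/
theorem invR_of_spread {t : ℕ} {k : ℤ} (k0 : 0 ≤ k)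
    (hk : P.x t + 2 * P.D - P.M - 1 ≤ k) (hj : ∀ j, 0 ≤ j → j ≤ k → P.tok t (P.D - j)) :
    P.InvR t := by
  have h0 : P.tok t P.D := by simpa using hj 0 le_rfl k0
  refine ⟨h0, ?_⟩
  by_cases hw : P.D ≤ P.M - P.D - P.x t + 1
  · exact tok_ge le_rfl hw h0
  · have := hj (P.x t + 2 * P.D - P.M - 1) (by omega) hk
    rwa [show P.D - (P.x t + 2 * P.D - P.M - 1) = P.M - P.D - P.x t + 1 by ring] at this

/-- A discrete intermediate value theorem. -/
theorem exists_eq_of_le_succ {f : ℕ → ℤ} (hf : ∀ r, f (r + 1) ≤ f r + 1) {s t : ℕ} (hst : s ≤ t)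
    {c : ℤ} (hs : f s < c) (ht : c ≤ f t) : ∃ r, s < r ∧ r ≤ t ∧ f r = c := by
  induction t, hst using Nat.le_induction with
  | base => omega
  | succ t hst ih =>
    by_cases h : c ≤ f t
    · obtain ⟨r, h1, h2, h3⟩ := ih h
      exact ⟨r, h1, by omega, h3⟩
    · exact ⟨t + 1, by omega, le_rfl, by have := hf t; omega⟩

theorem Legal.y_succ_le (h : P.Legal) (t : ℕ) : P.y (t + 1) ≤ P.y t + 1 := by
  have := h.cop t
  unfold Step at this
  omega

/-- From a visit to the SW corner at time `s` to the next corner visit, to the NW corner, at time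
`t`. If `InvR` holds at `s`, the right end of the NE edge is also the right end of the SE edge, and
while the cop climbs heat spreads along the SE edge far enough. If `InvT` holds at `s`, the right
end of the NE edge is hot by the time `r` at which the cop gets to `y = N - D + 1`. It can be
passed on to the SE edge at time `r` if the cop is not close to the right side; otherwise the cop
has come a long way, and heat goes around the sphere through the NW and SW edges. -/
theorem Legal.inv_NW (h : P.Legal) {s t : ℕ} (hst : s < t) (hs : P.AtSW s) (ht : P.flipY.AtSW t)
    (hNE : ∀ r, s ≤ r → r ≤ t → P.FreeNE r) (hSE : ∀ r, s ≤ r → r ≤ t → P.flipY.FreeNE r)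
    (hNW : ∀ r, s ≤ r → r < t → P.flipX.FreeNE r)
    (hSW : ∀ r, s < r → r ≤ t → P.flipX.flipY.FreeNE r)
    (hi : P.Inv s) : P.flipY.Inv t := by
  have w1 := h.width
  have w2 := h.height
  have w3 := h.room
  have w4 := h.two_le
  have xs := h.x_nonneg s
  have ys := h.y_nonneg s
  have xt := h.x_nonneg t
  have yt := h.y_le t
  unfold AtSW at hs ht
  simp only [flipY_x, flipY_y, flipY_D] at ht
  rcases hi with hi | hi
  · obtain ⟨r, sr, rt, hr⟩ := exists_eq_of_le_succ h.y_succ_le hst.le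
      (c := P.N - P.D + 1) (by omega) (by omega)
    have ir := h.invT_stay sr.le (fun q h1 h2 => hNE q h1 (by omega)) hi
    have it := h.invT_stay hst.le hNE hi
    have neD : P.tok r P.D := by
      have := ir.2
      rwa [show P.y r + 2 * P.D - P.N - 1 = P.D by omega] at this
    by_cases hR : P.x r + P.D ≤ P.M
    · obtain ⟨k, k0, -, k2, -, hj⟩ := h.flipY.spread_down rt (fun q h1 h2 => hSE q (by omega) h2)
        (h.tok_flipY hR neD)
      simp only [flipY_y] at k2
      exact .inr (invR_of_spread k0 (by simp only [flipY_x, flipY_D, flipY_M]; omega) hj)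
    · have rt' : r < t := lt_of_le_of_ne rt (by rintro rfl; omega)
      obtain ⟨k, k0, -, -, k3, hj⟩ := h.flipX.spread_up sr.le
        (fun q h1 h2 => hNW q h1 (by omega)) (h.tok_flipX (by omega) hi.1)
      simp only [flipX_x, flipX_y] at k3
      have nwD : P.flipX.tok r P.D := by simpa using hj P.D (by omega) (by omega)
      have swD := h.flipX.tok_flipY (by simp only [flipX_x, flipX_D, flipX_M]; omega) nwD
      obtain ⟨l, l0, -, -, l3, hl⟩ := h.flipX.flipY.spread_down rt
        (fun q h1 h2 => hSW q (by omega) h2) swD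
      simp only [flipX_x, flipX_y, flipY_x, flipY_y, flipX_N] at l3
      have sw0 : P.flipX.flipY.tok t 0 := by simpa using hl P.D (by omega) (by omega)
      -- Near the left side the right end of the NE edge serves again, and further to the right the
      -- cop is so near the top that `InvT` asks only for the end of the SE edge.
      by_cases hx : P.x t ≤ P.M - 2 * P.D + 1
      · have neD : P.tok t P.D := tok_ge (by omega) le_rfl it.2
        have seD := h.tok_flipY (by omega) neD
        exact .inr ⟨seD, tok_ge le_rfl (by simp only [flipY_x, flipY_D, flipY_M]; omega) seD⟩
      · have se0 : P.flipY.tok t 0 := by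
          have := h.flipX.flipY.tok_flipX (t := t)
            (by simp only [flipX_y, flipY_y, flipX_N, flipX_D, flipY_N, flipY_D]; omega) sw0
          rwa [flipY_flipX, flipX_flipX] at this
        exact .inl ⟨se0, tok_nonpos le_rfl
          (by simp only [flipY_y, flipY_D, flipY_N]; omega) se0⟩
  · obtain ⟨k, k0, -, k2, -, hj⟩ := h.flipY.spread_down hst.le hSE
      (h.tok_flipY (by omega) hi.1)
    simp only [flipY_y] at k2
    exact .inr (invR_of_spread k0 (by simp only [flipY_x, flipY_D, flipY_M]; omega) hj)

/-- From a visit to the SW corner at time `s`, where `InvT` holds, to the next corner visit, to the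
opposite corner NE, at time `t`. Heat goes through the NW edge to the left end of the SW edge, which
is enough unless the cop is relatively far from the right side at time `t`. In that case consider
the time `r` at which the cop gets to `y = N - D + 1`: heat goes through the SE edge to the bottom
end of the SW edge if the cop is not close to the right side at time `r`, and along the SW edge
otherwise. -/
theorem Legal.inv_NE_of_invT (h : P.Legal) {s t : ℕ} (hst : s < t) (hs : P.AtSW s)
    (ht : P.flipX.flipY.AtSW t)
    (hNE : ∀ r, s ≤ r → r < t → P.FreeNE r) (hSE : ∀ r, s ≤ r → r ≤ t → P.flipY.FreeNE r)
    (hNW : ∀ r, s ≤ r → r ≤ t → P.flipX.FreeNE r)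
    (hSW : ∀ r, s < r → r ≤ t → P.flipX.flipY.FreeNE r)
    (hi : P.InvT s) : P.flipX.flipY.Inv t := by
  have w1 := h.width
  have w2 := h.height
  have w3 := h.room
  have w4 := h.two_le
  have xs := h.x_nonneg s
  have ys := h.y_nonneg s
  have xt := h.x_le t
  have yt := h.y_le t
  unfold AtSW at hs ht
  simp only [flipY_x, flipY_y, flipY_D, flipX_x, flipX_y, flipX_D, flipX_N] at ht
  have swD : ∀ r, s ≤ r → r ≤ t → P.M - P.D + 1 ≤ P.x r → P.N - P.D + 1 ≤ P.y r →
      P.flipX.flipY.tok r P.D := by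
    intro r sr rt hx hy
    obtain ⟨k, k0, -, -, k3, hj⟩ := h.flipX.spread_up sr
      (fun q h1 h2 => hNW q h1 (by omega)) (h.tok_flipX (by omega) hi.1)
    simp only [flipX_x, flipX_y] at k3
    have nwD : P.flipX.tok r P.D := by simpa using hj P.D (by omega) (by omega)
    exact h.flipX.tok_flipY (by simp only [flipX_x, flipX_D, flipX_M]; omega) nwD
  by_cases hx : 2 * P.D - 1 ≤ P.x t
  · have := swD t hst.le le_rfl (by omega) (by omega)
    exact .inr ⟨this, tok_ge le_rfl
      (by simp only [flipX_x, flipX_D, flipX_M, flipY_x, flipY_D, flipY_M]; omega) this⟩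
  obtain ⟨r, sr, rt, hr⟩ := exists_eq_of_le_succ h.y_succ_le hst.le
    (c := P.N - P.D + 1) (by omega) (by omega)
  by_cases hR : P.x r + P.D ≤ P.M
  · have rt' : r < t := lt_of_le_of_ne rt (by rintro rfl; omega)
    have ir := h.invT_stay sr.le (fun q h1 h2 => hNE q h1 (by omega)) hi
    have neD : P.tok r P.D := by
      have := ir.2
      rwa [show P.y r + 2 * P.D - P.N - 1 = P.D by omega] at this
    obtain ⟨k, k0, -, -, k3, hj⟩ := h.flipY.spread_down rt (fun q h1 h2 => hSE q (by omega) h2)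
        (h.tok_flipY hR neD)
    simp only [flipY_x, flipY_y] at k3
    have se0 : P.flipY.tok t 0 := by simpa using hj P.D (by omega) (by omega)
    have sw0 := h.flipY.tok_flipX (by simp only [flipY_y, flipY_D, flipY_N]; omega) se0
    rw [flipY_flipX] at sw0
    exact .inl ⟨sw0, tok_nonpos le_rfl
          (by simp only [flipY_y, flipY_D, flipY_N, flipX_y, flipX_D, flipX_N]; omega) sw0⟩
  · obtain ⟨k, k0, -, k2, -, hj⟩ := h.flipX.flipY.spread_down rt
        (fun q h1 h2 => hSW q (by omega) h2) (swD r sr.le rt (by omega) (by omega))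
    simp only [flipX_y, flipY_y, flipX_N] at k2
    exact .inr (invR_of_spread k0
      (by simp only [flipY_x, flipY_D, flipY_M, flipX_x, flipX_D, flipX_M]; omega) hj)

/-! ### Passing the invariant from corner to corner -/

/-- The cop is at distance at least `D` from all four corners. -/
def Quiet (P : Chase) (t : ℕ) : Prop :=
  P.FreeNE t ∧ P.flipX.FreeNE t ∧ P.flipY.FreeNE t ∧ P.flipX.flipY.FreeNE t

/-- The cop is in one of the corners, and the opposite edge of the sphere has the property `Inv`. -/
def Good (P : Chase) (t : ℕ) : Prop :=
  (P.AtSW t ∧ P.Inv t) ∨ (P.flipX.AtSW t ∧ P.flipX.Inv t) ∨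
    (P.flipY.AtSW t ∧ P.flipY.Inv t) ∨ (P.flipX.flipY.AtSW t ∧ P.flipX.flipY.Inv t)

theorem quiet_flipX {t : ℕ} : P.flipX.Quiet t ↔ P.Quiet t := by
  simp only [Quiet, flipX_flipX]; tauto

theorem quiet_flipY {t : ℕ} : P.flipY.Quiet t ↔ P.Quiet t := by
  simp only [Quiet, flipY_flipX, flipY_flipY]; tauto

theorem good_flipX {t : ℕ} : P.flipX.Good t ↔ P.Good t := by
  simp only [Good, flipX_flipX]; tauto

theorem good_flipY {t : ℕ} : P.flipY.Good t ↔ P.Good t := by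
  simp only [Good, flipY_flipX, flipY_flipY]; tauto

theorem not_quiet {t : ℕ} (hq : ¬ P.Quiet t) :
    P.AtSW t ∨ P.flipX.AtSW t ∨ P.flipY.AtSW t ∨ P.flipX.flipY.AtSW t := by
  unfold Quiet FreeNE at hq
  unfold AtSW
  simp only [flipX_D, flipX_M, flipX_N, flipX_x, flipX_y, flipY_D, flipY_M, flipY_N, flipY_x,
    flipY_y] at *
  omega

theorem Legal.freeNE (h : P.Legal) {t : ℕ} (ht : P.AtSW t) : P.FreeNE t := by
  have := h.width
  have := h.height
  have := h.two_le
  unfold AtSW at ht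
  unfold FreeNE
  omega

theorem Legal.freeNE_flipX (h : P.Legal) {t : ℕ} (ht : P.AtSW t) : P.flipX.FreeNE t := by
  have := h.width
  have := h.height
  have := h.x_nonneg t
  have := h.y_nonneg t
  unfold AtSW at ht
  unfold FreeNE
  simp only [flipX_D, flipX_M, flipX_N, flipX_x, flipX_y]
  omega

theorem Legal.freeNE_flipY (h : P.Legal) {t : ℕ} (ht : P.AtSW t) : P.flipY.FreeNE t := by
  have := h.width
  have := h.height
  have := h.x_nonneg t
  have := h.y_nonneg t
  unfold AtSW at ht
  unfold FreeNE
  simp only [flipY_D, flipY_M, flipY_N, flipY_x, flipY_y]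
  omega

/-- The passage from a visit to the SW corner to the next corner visit. The SE corner reduces to the
NW corner by `swap`, and the case `InvR` at the NE corner to the case `InvT`. -/
theorem Legal.good_of_AtSW (h : P.Legal) {s t : ℕ} (hst : s < t) (hs : P.AtSW s) (hi : P.Inv s)
    (hq : ∀ r, s < r → r < t → P.Quiet r) (ht : ¬ P.Quiet t) : P.Good t := by
  have hNE : ∀ r, s ≤ r → r < t → P.FreeNE r := fun r h1 h2 =>
    (eq_or_lt_of_le h1).elim (fun e => e ▸ h.freeNE hs) fun h1 => (hq r h1 h2).1
  have hNW : ∀ r, s ≤ r → r < t → P.flipX.FreeNE r := fun r h1 h2 =>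
    (eq_or_lt_of_le h1).elim (fun e => e ▸ h.freeNE_flipX hs) fun h1 => (hq r h1 h2).2.1
  have hSE : ∀ r, s ≤ r → r < t → P.flipY.FreeNE r := fun r h1 h2 =>
    (eq_or_lt_of_le h1).elim (fun e => e ▸ h.freeNE_flipY hs) fun h1 => (hq r h1 h2).2.2.1
  have hSW : ∀ r, s < r → r < t → P.flipX.flipY.FreeNE r := fun r h1 h2 => (hq r h1 h2).2.2.2
  have extend : ∀ {p : ℕ → Prop}, (∀ r, s ≤ r → r < t → p r) → p t → ∀ r, s ≤ r → r ≤ t → p r :=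
    fun hp ht r h1 h2 => (eq_or_lt_of_le h2).elim (fun e => e ▸ ht) (hp r h1)
  have extend' : ∀ {p : ℕ → Prop}, (∀ r, s < r → r < t → p r) → p t →
      ∀ r, s < r → r ≤ t → p r :=
    fun hp ht r h1 h2 => (eq_or_lt_of_le h2).elim (fun e => e ▸ ht) (hp r h1)
  have hswap : ∀ {r : ℕ}, P.flipX.FreeNE r → P.swap.flipY.FreeNE r := fun hf => hf.swap
  have hswap' : ∀ {r : ℕ}, P.flipY.FreeNE r → P.swap.flipX.FreeNE r := fun hf => hf.swap
  have hswap'' : ∀ {r : ℕ}, P.flipX.flipY.FreeNE r → P.swap.flipX.flipY.FreeNE r :=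
    fun hf => hf.swap
  have hs' : P.swap.AtSW s := by
    unfold AtSW at *; simp only [swap_D, swap_x, swap_y]; omega
  rcases not_quiet ht with ht | ht | ht | ht
  · exact .inl ⟨ht, h.inv_stay hst.le (extend hNE (h.freeNE ht)) hi⟩
  · have a1 := h.flipX.freeNE_flipX ht
    have a2 := h.flipX.freeNE_flipY ht
    have a3 := h.flipX.freeNE ht
    rw [flipX_flipX] at a1
    refine .inr (.inl ⟨ht, ?_⟩)
    have ht' : P.swap.flipY.AtSW t := by
      unfold AtSW at *
      simp only [flipX_D, flipX_x, flipX_y, swap_D, swap_x, swap_y, swap_N, flipY_D, flipY_x,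
        flipY_y] at *
      omega
    have := h.swap.inv_NW hst hs' ht' (fun r h1 h2 => (extend hNE a1 r h1 h2).swap)
      (fun r h1 h2 => hswap (extend hNW a3 r h1 h2)) (fun r h1 h2 => hswap' (hSE r h1 h2))
      (fun r h1 h2 => hswap'' (extend' hSW a2 r h1 h2)) (h.inv_swap (h.freeNE hs) hi)
    exact h.swap.flipY.inv_swap (hswap a3) this
  · have a1 := h.flipY.freeNE_flipX ht
    have a2 := h.flipY.freeNE_flipY ht
    have a3 := h.flipY.freeNE ht
    rw [flipY_flipY] at a2
    rw [flipY_flipX] at a1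
    exact .inr (.inr (.inl ⟨ht, h.inv_NW hst hs ht (extend hNE a2) (extend hSE a3) hNW
      (extend' hSW a1) hi⟩))
  · have a1 := h.flipX.flipY.freeNE_flipX ht
    have a2 := h.flipX.flipY.freeNE_flipY ht
    have a3 := h.flipX.flipY.freeNE ht
    rw [flipY_flipX, flipX_flipX] at a1
    rw [flipY_flipY] at a2
    refine .inr (.inr (.inr ⟨ht, ?_⟩))
    rcases hi with hi | hi
    · exact h.inv_NE_of_invT hst hs ht hNE (extend hSE a1) (extend hNW a2) (extend' hSW a3) hi
    · have ht' : P.swap.flipX.flipY.AtSW t := by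
        unfold AtSW at *
        simp only [flipX_D, flipX_x, flipX_y, swap_D, swap_x, swap_y, swap_N, swap_M, flipX_N,
          flipY_D, flipY_x, flipY_y] at *
        omega
      have := h.swap.inv_NE_of_invT hst hs' ht' (fun r h1 h2 => (hNE r h1 h2).swap)
        (fun r h1 h2 => hswap (extend hNW a2 r h1 h2))
        (fun r h1 h2 => hswap' (extend hSE a1 r h1 h2))
        (fun r h1 h2 => hswap'' (extend' hSW a3 r h1 h2)) (h.invT_swap (h.freeNE hs) hi)
      exact h.swap.flipX.flipY.inv_swap (hswap'' a3) this

theorem Legal.good_of_good (h : P.Legal) {s t : ℕ} (hst : s < t) (hs : P.Good s)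
    (hq : ∀ r, s < r → r < t → P.Quiet r) (ht : ¬ P.Quiet t) : P.Good t := by
  rcases hs with ⟨hs, hi⟩ | ⟨hs, hi⟩ | ⟨hs, hi⟩ | ⟨hs, hi⟩
  · exact h.good_of_AtSW hst hs hi hq ht
  · exact good_flipX.1 <| h.flipX.good_of_AtSW hst hs hi
      (fun r h1 h2 => quiet_flipX.2 (hq r h1 h2)) (mt quiet_flipX.1 ht)
  · exact good_flipY.1 <| h.flipY.good_of_AtSW hst hs hi
      (fun r h1 h2 => quiet_flipY.2 (hq r h1 h2)) (mt quiet_flipY.1 ht)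
  · exact good_flipX.1 <| good_flipY.1 <| h.flipX.flipY.good_of_AtSW hst hs hi
      (fun r h1 h2 => quiet_flipY.2 (quiet_flipX.2 (hq r h1 h2)))
      (mt (fun hh => quiet_flipX.1 (quiet_flipY.1 hh)) ht)

/-- Before the first corner visit the tokens are hot since the start. -/
theorem Legal.inv_of_first (h : P.Legal) {t : ℕ} (ht : P.AtSW t)
    (hf : ∀ r, r < t → P.FreeNE r) : P.Inv t := by
  have hf' : ∀ r, 0 ≤ r → r ≤ t → P.FreeNE r := fun r _ h2 =>
    (eq_or_lt_of_le h2).elim (fun e => e ▸ h.freeNE ht) (hf r)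
  have f0 := hf' 0 le_rfl t.zero_le
  exact .inl (h.invT_stay t.zero_le hf' ⟨h.tok_zero f0 _, h.tok_zero f0 _⟩)

theorem Legal.good_of_first (h : P.Legal) {t : ℕ} (ht : ¬ P.Quiet t)
    (hq : ∀ r, r < t → P.Quiet r) : P.Good t := by
  rcases not_quiet ht with ht | ht | ht | ht
  · exact .inl ⟨ht, h.inv_of_first ht fun r hr => (hq r hr).1⟩
  · exact .inr (.inl ⟨ht, h.flipX.inv_of_first ht fun r hr => (hq r hr).2.1⟩)
  · exact .inr (.inr (.inl ⟨ht, h.flipY.inv_of_first ht fun r hr => (hq r hr).2.2.1⟩))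
  · exact .inr (.inr (.inr ⟨ht, h.flipX.flipY.inv_of_first ht fun r hr => (hq r hr).2.2.2⟩))

theorem Legal.quiet_or_good (h : P.Legal) (t : ℕ) :
    (∀ r, r ≤ t → P.Quiet r) ∨ ∃ s, s ≤ t ∧ P.Good s ∧ ∀ r, s < r → r ≤ t → P.Quiet r := by
  induction t with
  | zero =>
    by_cases hq : P.Quiet 0
    · exact .inl fun r hr => by rwa [Nat.le_zero.1 hr]
    · exact .inr ⟨0, le_rfl, h.good_of_first hq (by simp), by omega⟩
  | succ t ih =>
    by_cases hq : P.Quiet (t + 1)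
    · refine ih.imp (fun hr r h2 => ?_) fun ⟨s, st, hs, hr⟩ => ⟨s, by omega, hs, fun r h1 h2 => ?_⟩
      · exact (Nat.le_succ_iff.1 h2).elim (hr r) (fun e => e ▸ hq)
      · exact (Nat.le_succ_iff.1 h2).elim (hr r h1) (fun e => e ▸ hq)
    · refine .inr ⟨t + 1, le_rfl, ?_, by omega⟩
      rcases ih with hr | ⟨s, st, hs, hr⟩
      · exact h.good_of_first hq fun r h2 => hr r (by omega)
      · exact h.good_of_good (by omega) hs (fun r h1 h2 => hr r h1 (by omega)) hq

theorem Legal.exists_tok (h : P.Legal) {s t : ℕ} (hst : s ≤ t) (hs : P.AtSW s) (hi : P.Inv s)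
    (hf : ∀ r, s < r → r ≤ t → P.FreeNE r) : ∃ w, P.tok t w := by
  have hf' : ∀ r, s ≤ r → r ≤ t → P.FreeNE r := fun r h1 h2 =>
    (eq_or_lt_of_le h1).elim (fun e => e ▸ h.freeNE hs) fun h1 => hf r h1 h2
  rcases hi with hi | hi
  · exact ⟨_, h.tok_stay hst hf' hi.1⟩
  · exact ⟨_, h.tok_stay hst hf' hi.1⟩

theorem Legal.exists_hot (h : P.Legal) (t : ℕ) : ∃ u v, P.hot t u v := by
  rcases h.quiet_or_good t with hr | ⟨s, st, hs, hr⟩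
  · exact ⟨_, _, h.tok_stay t.zero_le (fun r _ h2 => (hr r h2).1)
      (h.tok_zero (hr 0 t.zero_le).1 0)⟩
  · rcases hs with ⟨hs, hi⟩ | ⟨hs, hi⟩ | ⟨hs, hi⟩ | ⟨hs, hi⟩
    · obtain ⟨w, hw⟩ := h.exists_tok st hs hi fun r h1 h2 => (hr r h1 h2).1
      exact ⟨_, _, hw⟩
    · obtain ⟨w, hw⟩ := h.flipX.exists_tok st hs hi fun r h1 h2 => (hr r h1 h2).2.1
      exact ⟨_, _, hw⟩
    · obtain ⟨w, hw⟩ := h.flipY.exists_tok st hs hi fun r h1 h2 => (hr r h1 h2).2.2.1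
      exact ⟨_, _, hw⟩
    · obtain ⟨w, hw⟩ := h.flipX.flipY.exists_tok st hs hi fun r h1 h2 => (hr r h1 h2).2.2.2
      exact ⟨_, _, hw⟩

end Chase

/-! ### Distances in the grid -/

namespace SimpleGraph

theorem natAbs_sub_le_length_pathGraph {n : ℕ} {i j : Fin n} (w : (pathGraph n).Walk i j) :
    ((i : ℤ) - j).natAbs ≤ w.length := by
  induction w with
  | nil => simp
  | cons h w ih =>
    rw [pathGraph_adj] at h
    rw [Walk.length_cons]
    omega

theorem edist_pathGraph_le {n : ℕ} (d : ℕ) (i j : Fin n) (h : (j : ℕ) = i + d) :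
    (pathGraph n).edist i j ≤ d := by
  induction d generalizing j with
  | zero => rw [show i = j from Fin.ext (by omega)]; simp
  | succ d ih =>
    have hk : (i : ℕ) + d < n := by omega
    have hadj : (pathGraph n).Adj ⟨i + d, hk⟩ j := by
      rw [pathGraph_adj]; left; simp only; omega
    calc (pathGraph n).edist i j
        ≤ (pathGraph n).edist i ⟨i + d, hk⟩ + (pathGraph n).edist ⟨i + d, hk⟩ j :=
          SimpleGraph.edist_triangle
      _ ≤ d + 1 := add_le_add (ih _ rfl) (edist_eq_one_iff_adj.2 hadj).le
      _ = ((d + 1 : ℕ) : ℕ∞) := by push_cast; rfl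

theorem edist_pathGraph {n : ℕ} (i j : Fin n) :
    (pathGraph n).edist i j = (((i : ℤ) - j).natAbs : ℕ∞) := by
  apply le_antisymm
  · rcases le_total (i : ℕ) j with h | h
    · exact edist_pathGraph_le _ i j (by omega)
    · rw [edist_comm]
      exact edist_pathGraph_le _ j i (by omega)
  · exact le_iInf fun w => by exact_mod_cast natAbs_sub_le_length_pathGraph w

theorem edist_grid {n m : ℕ} (p q : Fin n × Fin m) :
    (pathGraph n □ pathGraph m).edist p q =
      ((((p.1 : ℤ) - q.1).natAbs + ((p.2 : ℤ) - q.2).natAbs : ℕ) : ℕ∞) := by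
  rw [edist_boxProd, edist_pathGraph, edist_pathGraph]
  push_cast
  rfl

theorem grid_adj_iff {n m : ℕ} (p q : Fin n × Fin m) :
    (q = p ∨ (pathGraph n □ pathGraph m).Adj p q) ↔ Chase.Step p.2 p.1 q.2 q.1 := by
  obtain ⟨⟨a, ha⟩, ⟨b, hb⟩⟩ := p
  obtain ⟨⟨a', ha'⟩, ⟨b', hb'⟩⟩ := q
  simp only [boxProd_adj, pathGraph_adj, Prod.mk.injEq, Fin.mk.injEq, Chase.Step]
  omega

/-! ### The cop sweeping the middle row -/

/-- The cop walks along the middle row. The column of the robber stays strictly to the right of that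
of the cop, since in the same column they are at distance at most `n / 2`. -/
theorem patrolWins_grid {n m : ℕ} (hn : 1 ≤ n) (hm : 1 ≤ m) :
    (pathGraph n □ pathGraph m).PatrolWins (n / 2) := by
  refine ⟨fun t => (⟨n / 2, by omega⟩, ⟨min t (m - 1), by omega⟩), fun t => ?_, fun r hr => ?_⟩
  · rw [grid_adj_iff]
    simp only [Chase.Step]
    have : min (t + 1) (m - 1) = min t (m - 1) ∨
        min (t + 1) (m - 1) = min t (m - 1) + 1 := by omega
    rcases this with e | e <;> simp [e]
  · by_contra hc
    simp only [IsCaptured, edist_grid, Nat.cast_le, not_exists, not_or, not_le] at hc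
    have key : ∀ t, min t (m - 1) < (r t).2.val := by
      intro t
      induction t with
      | zero => have := (hc 0).1; have := (r 0).1.isLt; omega
      | succ t ih =>
        have h1 := (hc t).2
        have h2 := (hc (t + 1)).1
        have h3 := (r t).1.isLt
        have h4 := (r (t + 1)).1.isLt
        have h5 := (grid_adj_iff _ _).1 (hr t)
        unfold Chase.Step at h5
        omega
    have := key (m - 1)
    have := (r (m - 1)).2.isLt
    omega

/-! ### Escaping for all times -/

/-- König's lemma on a finite set: if every `S t` is nonempty and every point of `S (t + 1)` has an
`R`-predecessor in `S t`, then there is an infinite `R`-path through the sets `S t`. -/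
theorem exists_seq_of_finite {V : Type*} [Finite V] {R : V → V → Prop} {S : ℕ → V → Prop}
    (hS : ∀ t, ∃ p, S t p) (hR : ∀ t p, S (t + 1) p → ∃ q, S t q ∧ R q p) :
    ∃ r : ℕ → V, ∀ t, S t (r t) ∧ R (r t) (r (t + 1)) := by
  have hfin : ∀ T p, S T p → ∃ r : ℕ → V, r T = p ∧ (∀ t, t ≤ T → S t (r t)) ∧
      ∀ t, t < T → R (r t) (r (t + 1)) := by
    intro T
    induction T with
    | zero => exact fun p hp => ⟨fun _ => p, rfl, fun t ht => by rwa [Nat.le_zero.1 ht], by simp⟩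
    | succ T ih =>
      intro p hp
      obtain ⟨q, hq, hqp⟩ := hR T p hp
      obtain ⟨r, rfl, h1, h2⟩ := ih q hq
      refine ⟨fun t => if t ≤ T then r t else p, by simp, fun t ht => ?_, fun t ht => ?_⟩
      · rcases Nat.le_succ_iff.1 ht with ht | rfl
        · simpa [ht] using h1 t ht
        · simpa using hp
      · rcases Nat.lt_succ_iff_lt_or_eq.1 ht with ht | rfl
        · simpa [ht.le, Nat.succ_le_of_lt ht] using h2 t ht
        · simpa using hqp
  choose p hp using hS
  choose r _ h1 h2 using fun T => hfin T (p T) (hp T)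
  -- The limit of the finite paths along an ultrafilter exists because `V` is finite.
  have hlim : ∀ t, ∃ v, ∀ᶠ T in (Filter.hyperfilter ℕ : Filter ℕ), r T t = v := fun t => by
    have := (Ultrafilter.eventually_exists_iff (f := Filter.hyperfilter ℕ)
      (P := fun v T => r T t = v)).1 (Filter.Eventually.of_forall fun T => ⟨_, rfl⟩)
    exact this
  choose v hv using hlim
  refine ⟨v, fun t => ?_⟩
  obtain ⟨T, e1, e2, hT⟩ := ((hv t).and ((hv (t + 1)).and
    (Nat.hyperfilter_le_atTop (Filter.eventually_gt_atTop t)))).exists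
  rw [← e1, ← e2]
  exact ⟨h1 T t hT.le, h2 T t hT⟩

/-- The points at which a robber who has kept distance at least `k` from the patrol `c` after each
of his moves can be at time `t`. -/
def Reach {V : Type*} (G : SimpleGraph V) (k : ℕ) (c : ℕ → V) : ℕ → V → Prop
  | 0, p => (k : ℕ∞) ≤ G.edist p (c 0)
  | t + 1, p => (k : ℕ∞) ≤ G.edist p (c (t + 1)) ∧ ∃ q, Reach G k c t q ∧ (p = q ∨ G.Adj q p)

theorem Reach.le_edist {V : Type*} {G : SimpleGraph V} {k : ℕ} {c : ℕ → V} {t : ℕ} {p : V}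
    (h : G.Reach k c t p) : (k : ℕ∞) ≤ G.edist p (c t) := by
  cases t with
  | zero => exact h
  | succ t => exact h.1

/-- Distance `ρ + 2` after the moves of the robber leaves distance `ρ + 1` after the moves of the
cop. -/
theorem exists_not_isCaptured {V : Type*} [Finite V] {G : SimpleGraph V} {ρ : ℕ} {c : ℕ → V}
    (hc : G.IsLazyWalk c) (h : ∀ t, ∃ p, G.Reach (ρ + 2) c t p) :
    ∃ r, G.IsLazyWalk r ∧ ¬ G.IsCaptured ρ c r := by
  obtain ⟨r, hr⟩ := exists_seq_of_finite (R := fun q p => p = q ∨ G.Adj q p) h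
    fun t p hp => hp.2
  refine ⟨r, fun t => (hr t).2, ?_⟩
  rintro ⟨t, ht⟩
  have h1 := (hr t).1.le_edist
  have h2 : G.edist (c (t + 1)) (c t) ≤ 1 := by
    rcases hc t with h | h
    · rw [h]; simp
    · exact (edist_eq_one_iff_adj.2 h.symm).le
  have h3 : G.edist (r t) (c t) ≤ ((ρ + 1 : ℕ) : ℕ∞) := by
    rcases ht with ht | ht
    · rw [edist_comm]
      exact ht.trans (by exact_mod_cast Nat.le_succ ρ)
    · rw [edist_comm] at ht
      calc _ ≤ G.edist (r t) (c (t + 1)) + G.edist (c (t + 1)) (c t) := SimpleGraph.edist_triangle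
        _ ≤ ρ + 1 := add_le_add ht h2
        _ = _ := by push_cast; rfl
  have := h1.trans h3
  rw [Nat.cast_le] at this
  omega

/-! ### The robber on the grid -/

/-- The chase of a patrol `c` on the grid: the second coordinate of a vertex is `x`, the first is
`y`, and the hot points are those where a robber keeping distance `ρ + 2` can be. -/
def gridChase {n m : ℕ} (ρ : ℕ) (c : ℕ → Fin n × Fin m) : Chase where
  D := ρ + 2
  M := m - 1
  N := n - 1
  x t := (c t).2
  y t := (c t).1
  hot t u v := ∃ p : Fin n × Fin m, (p.2 : ℤ) = u ∧ (p.1 : ℤ) = v ∧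
    (pathGraph n □ pathGraph m).Reach (ρ + 2) c t p

theorem le_edist_grid_iff {n m k : ℕ} (p q : Fin n × Fin m) :
    (k : ℕ∞) ≤ (pathGraph n □ pathGraph m).edist p q ↔
      (k : ℤ) ≤ |(p.2 : ℤ) - q.2| + |(p.1 : ℤ) - q.1| := by
  rw [edist_grid, Nat.cast_le, ← Int.natCast_natAbs, ← Int.natCast_natAbs]
  omega

theorem legal_gridChase {n m ρ : ℕ} (h1 : 2 * ρ + 4 ≤ n) (h2 : 8 * ρ + 11 ≤ 2 * m + n)
    (hnm : n ≤ m) {c : ℕ → Fin n × Fin m} (hc : (pathGraph n □ pathGraph m).IsLazyWalk c) :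
    (gridChase ρ c).Legal where
  two_le := by simp only [gridChase]; omega
  width := by simp only [gridChase]; omega
  height := by simp only [gridChase]; omega
  room := by simp only [gridChase]; omega
  x_nonneg t := by simp only [gridChase]; omega
  x_le t := by simp only [gridChase]; omega
  y_nonneg t := by simp only [gridChase]; omega
  y_le t := by simp only [gridChase]; omega
  cop t := (grid_adj_iff _ _).1 (hc t)
  start u v hu hu' hv hv' hd := by
    simp only [gridChase] at *
    lift u to ℕ using hu
    lift v to ℕ using hv
    refine ⟨(⟨v, by omega⟩, ⟨u, by omega⟩), rfl, rfl, (le_edist_grid_iff _ _).2 ?_⟩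
    push_cast
    exact hd
  next t u v u' v' hh hs hu hu' hv hv' hd := by
    obtain ⟨p, rfl, rfl, hp⟩ := hh
    simp only [gridChase] at *
    lift u' to ℕ using hu
    lift v' to ℕ using hv
    refine ⟨(⟨v', by omega⟩, ⟨u', by omega⟩), rfl, rfl, (le_edist_grid_iff _ _).2 ?_, p, hp,
      (grid_adj_iff _ _).2 hs⟩
    push_cast
    exact hd

theorem not_patrolWins_grid {n m ρ : ℕ} (h1 : 2 * ρ + 4 ≤ n) (h2 : 8 * ρ + 11 ≤ 2 * m + n)
    (hnm : n ≤ m) : ¬ (pathGraph n □ pathGraph m).PatrolWins ρ := by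
  rintro ⟨c, hc, hw⟩
  obtain ⟨r, hr, hr'⟩ := exists_not_isCaptured (ρ := ρ) hc fun t => by
    obtain ⟨u, v, p, -, -, hp⟩ := (legal_gridChase h1 h2 hnm hc).exists_hot t
    exact ⟨p, hp⟩
  exact hr' (hw r hr)

end SimpleGraph

/-! ### Bounds on the patrol range of the grid -/

theorem mainTheorem7 (n m : ℕ) (hn : 1 ≤ n) (hnm : n ≤ m) :
    min (((n : ℝ) - 3) / 2) ((2 * (m : ℝ) + (n : ℝ) - 10) / 8)
        ≤ ((SimpleGraph.pathGraph n □ SimpleGraph.pathGraph m).patrolRange : ℝ) ∧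
      ((SimpleGraph.pathGraph n □ SimpleGraph.pathGraph m).patrolRange : ℝ) ≤ (n : ℝ) / 2 := by
  have hwin := SimpleGraph.patrolWins_grid hn (hn.trans hnm)
  constructor
  · by_contra! hlt
    rw [lt_min_iff] at hlt
    have hmem : (SimpleGraph.pathGraph n □ SimpleGraph.pathGraph m).PatrolWins
        (SimpleGraph.pathGraph n □ SimpleGraph.pathGraph m).patrolRange :=
      Nat.sInf_mem (s := {ρ | SimpleGraph.PatrolWins _ ρ}) ⟨_, hwin⟩
    generalize (SimpleGraph.pathGraph n □ SimpleGraph.pathGraph m).patrolRange = ρ at *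
    obtain ⟨h1, h2⟩ := hlt
    have h1' : 2 * ρ + 3 < n := by
      have : (2 * ρ + 3 : ℝ) < n := by linarith
      exact_mod_cast this
    have h2' : 8 * ρ + 10 < 2 * m + n := by
      have : (8 * ρ + 10 : ℝ) < 2 * m + n := by linarith
      exact_mod_cast this
    exact SimpleGraph.not_patrolWins_grid h1' h2' hnm hmem
  · have : (SimpleGraph.pathGraph n □ SimpleGraph.pathGraph m).patrolRange ≤ n / 2 :=
      Nat.sInf_le hwin
    calc ((SimpleGraph.pathGraph n □ SimpleGraph.pathGraph m).patrolRange : ℝ)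
        ≤ ((n / 2 : ℕ) : ℝ) := by exact_mod_cast this
      _ ≤ (n : ℝ) / 2 := Nat.cast_div_le
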